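/- For a non-negative integer $n$, let $p(n)$ be the number of partitions of $n$, that is, the number of weakly decreasing finite sequences of positive integers whose sum is $n$. Then \[ p(n) \ge \frac{2^{8\sqrt{n}/3}}{2^{5/2}\, n^{3/4}} \quad\text{for all integers } n \ge 2. \] -/

import Mathlib

open scoped Nat

namespace Nat.Partition

/-! Restrict to parts at most k. Conditioning on whether the largest allowed part occurs gives a
recurrence (`boundedCard_add_le`), from which p_{k+1}(n) ≥ n^k / ((k+1)! k!) follows by induction
(`pow_le_boundedCard_mul`). With k + 1 = ⌊√n⌋ this is of order at least e^{2⌊√n⌋} / n, and e^2 >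
2^{8/3}, so the claim holds once √n ≥ 24. For n < 576, parts at most 16 already suffice, as a kernel
computation with the recurrence shows. Twelfth powers clear the fractional exponents. -/

/-- The number of partitions of `n` all of whose parts are at most `k`. -/
def boundedCard (k n : ℕ) : ℕ := (restricted n (· ≤ k)).card

theorem boundedCard_le_card (k n : ℕ) : boundedCard k n ≤ Fintype.card (Nat.Partition n) :=
  Finset.card_le_univ _

theorem boundedCard_mono {k l : ℕ} (h : k ≤ l) (n : ℕ) : boundedCard k n ≤ boundedCard l n := by
  refine Finset.card_le_card fun p hp => ?_
  simp only [restricted, Finset.mem_filter, Finset.mem_univ, true_and] at hp ⊢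
  exact fun i hi => (hp i hi).trans h

/-- Adding a part `k + 1` to a partition of `n`. -/
def consPart (k : ℕ) {n : ℕ} (p : Nat.Partition n) : Nat.Partition (n + (k + 1)) where
  parts := (k + 1) ::ₘ p.parts
  parts_pos := by
    intro i hi
    rcases Multiset.mem_cons.1 hi with rfl | hi
    · exact k.succ_pos
    · exact p.parts_pos hi
  parts_sum := by rw [Multiset.sum_cons, p.parts_sum, add_comm]

theorem consPart_injective (k n : ℕ) :
    Function.Injective (consPart k : Nat.Partition n → Nat.Partition (n + (k + 1))) := by
  intro p q h
  have := congrArg Nat.Partition.parts h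
  exact Nat.Partition.ext ((Multiset.cons_inj_right (k + 1)).1 this)

theorem boundedCard_add_le (k n : ℕ) :
    boundedCard k (n + (k + 1)) + boundedCard (k + 1) n ≤ boundedCard (k + 1) (n + (k + 1)) := by
  unfold boundedCard
  rw [← Finset.card_map ⟨_, consPart_injective k n⟩, ← Finset.card_union_of_disjoint]
  · refine Finset.card_le_card fun p hp => ?_
    simp only [restricted, Finset.mem_union, Finset.mem_map, Finset.mem_filter, Finset.mem_univ,
      true_and, Function.Embedding.coeFn_mk] at hp ⊢
    rcases hp with hp | ⟨q, hq, rfl⟩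
    · exact fun i hi => (hp i hi).trans k.le_succ
    · intro i hi
      rcases Multiset.mem_cons.1 hi with rfl | hi
      · exact le_rfl
      · exact hq i hi
  · rw [Finset.disjoint_left]
    intro p hp hp'
    simp only [restricted, Finset.mem_map, Finset.mem_filter, Finset.mem_univ,
      true_and, Function.Embedding.coeFn_mk] at hp hp'
    obtain ⟨q, -, rfl⟩ := hp'
    have := hp (k + 1) (Multiset.mem_cons_self _ _)
    omega

theorem one_le_boundedCard_one (n : ℕ) : 1 ≤ boundedCard 1 n := by
  refine Finset.card_pos.2 ⟨ofSums n (Multiset.replicate n 1) (by simp), ?_⟩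
  simp only [restricted, Finset.mem_filter, Finset.mem_univ, true_and]
  intro i hi
  have h : i ∈ Multiset.replicate n 1 := Multiset.mem_of_le (Multiset.filter_le _ _) hi
  exact (Multiset.eq_of_mem_replicate h).le

/-- The mean value bound for x^(k+1), in the form that matches the recurrence with step m = k + 2.
-/
theorem pow_add_le (k m n : ℕ) : (n + m) ^ (k + 1) ≤ n ^ (k + 1) + (k + 1) * m * (n + m) ^ k := by
  induction k with
  | zero => simp
  | succ k ih =>
    have h : n ^ (k + 1) ≤ (n + m) ^ (k + 1) := Nat.pow_le_pow_left (by omega) _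
    calc (n + m) ^ (k + 2) = (n + m) ^ (k + 1) * n + m * (n + m) ^ (k + 1) := by ring
      _ ≤ (n ^ (k + 1) + (k + 1) * m * (n + m) ^ k) * n + m * (n + m) ^ (k + 1) := by gcongr
      _ = n ^ (k + 2) + (k + 1) * m * ((n + m) ^ k * n) + m * (n + m) ^ (k + 1) := by ring
      _ ≤ n ^ (k + 2) + (k + 1) * m * ((n + m) ^ k * (n + m)) + m * (n + m) ^ (k + 1) := by
        gcongr; omega
      _ = n ^ (k + 2) + (k + 1 + 1) * m * (n + m) ^ (k + 1) := by ring

theorem pow_le_boundedCard_mul (k n : ℕ) :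
    n ^ k ≤ boundedCard (k + 1) n * ((k + 1)! * k !) := by
  induction k generalizing n with
  | zero => simpa using one_le_boundedCard_one n
  | succ k ihk =>
    have hfac : (k + 2)! * (k + 1)! = (k + 1) * (k + 2) * ((k + 1)! * k !) := by
      rw [Nat.factorial_succ (k + 1), Nat.factorial_succ k]; ring
    induction n using Nat.strong_induction_on with
    | _ n ihn =>
      rcases lt_or_ge n (k + 2) with h | h
      -- Below k + 2 the new part does not fit, but n ≤ (k + 1)(k + 2) makes the previous bound
      -- enough.
      · calc n ^ (k + 1) = n * n ^ k := by ring
          _ ≤ ((k + 1) * (k + 2)) * (boundedCard (k + 1) n * ((k + 1)! * k !)) :=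
            Nat.mul_le_mul (by nlinarith) (ihk n)
          _ = boundedCard (k + 1) n * ((k + 2)! * (k + 1)!) := by rw [hfac]; ring
          _ ≤ boundedCard (k + 2) n * ((k + 2)! * (k + 1)!) :=
            Nat.mul_le_mul_right _ (boundedCard_mono (Nat.le_succ _) n)
      · obtain ⟨m, rfl⟩ := Nat.exists_eq_add_of_le' h
        calc (m + (k + 2)) ^ (k + 1)
            ≤ m ^ (k + 1) + (k + 1) * (k + 2) * (m + (k + 2)) ^ k := pow_add_le _ _ _
          _ ≤ boundedCard (k + 2) m * ((k + 2)! * (k + 1)!) + (k + 1) * (k + 2) *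
                (boundedCard (k + 1) (m + (k + 2)) * ((k + 1)! * k !)) :=
            Nat.add_le_add (ihn m (by omega)) (Nat.mul_le_mul_left _ (ihk _))
          _ = (boundedCard (k + 1) (m + (k + 2)) + boundedCard (k + 2) m) *
                ((k + 2)! * (k + 1)!) := by rw [hfac]; ring
          _ ≤ boundedCard (k + 2) (m + (k + 2)) * ((k + 2)! * (k + 1)!) :=
            Nat.mul_le_mul_right _ (boundedCard_add_le (k + 1) m)

theorem two_pow_mul_pow_le (k : ℕ) (hk : 23 ≤ k) :
    2 ^ 16 * (k + 1) ^ (12 * k + 15) ≤ (k + 2) ^ (12 * k + 15) := by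
  have hk' : (23 : ℝ) ≤ k := by exact_mod_cast hk
  have hpos : (0 : ℝ) < k + 1 := by positivity
  have hlog := Real.le_log_one_add_of_nonneg (x := 1 / ((k : ℝ) + 1)) (by positivity)
  have hfrac : 2 * (1 / ((k : ℝ) + 1)) / (1 / ((k : ℝ) + 1) + 2) = 2 / (2 * k + 3) := by
    field_simp; ring
  have hdiv : 1 + 1 / ((k : ℝ) + 1) = (k + 2) / (k + 1) := by field_simp; ring
  rw [hfrac, hdiv, Real.log_div (by positivity) (by positivity)] at hlog
  -- The right side is 12 - 6 / (2k + 3), while 16 log 2 is about 11.09.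
  have hbound : (16 : ℝ) * Real.log 2 ≤ (12 * k + 15) * (2 / (2 * k + 3)) := by
    have h2 := Real.log_two_lt_d9
    rw [mul_div_assoc', le_div_iff₀ (by positivity)]
    nlinarith
  have hkey : (16 : ℝ) * Real.log 2 + (12 * k + 15) * Real.log (k + 1) ≤
      (12 * k + 15) * Real.log (k + 2) := by
    nlinarith [mul_le_mul_of_nonneg_left hlog (by positivity : (0 : ℝ) ≤ 12 * k + 15)]
  have hreal : (2 : ℝ) ^ 16 * ((k : ℝ) + 1) ^ (12 * k + 15) ≤ ((k : ℝ) + 2) ^ (12 * k + 15) := by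
    rw [← Real.log_le_log_iff (by positivity) (by positivity),
      Real.log_mul (by positivity) (by positivity), Real.log_pow, Real.log_pow, Real.log_pow]
    push_cast
    exact hkey
  exact_mod_cast hreal

/-- A Stirling-type bound by induction; the ratio of consecutive cases is `two_pow_mul_pow_le`. -/
theorem two_pow_mul_factorial_le (k : ℕ) (hk : 23 ≤ k) :
    2 ^ (16 * (k + 2)) * ((k + 1)! * k !) ^ 6 ≤ 2 ^ 15 * (k + 1) ^ (12 * k + 9) := by
  induction k, hk using Nat.le_induction with
  | base => decide +kernel
  | succ k hk ih =>
    calc 2 ^ (16 * (k + 1 + 2)) * ((k + 1 + 1)! * (k + 1)!) ^ 6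
        = 2 ^ (16 * (k + 2)) * ((k + 1)! * k !) ^ 6 * (2 ^ 16 * ((k + 2) * (k + 1)) ^ 6) := by
          rw [Nat.factorial_succ (k + 1), Nat.factorial_succ k]; ring
      _ ≤ 2 ^ 15 * (k + 1) ^ (12 * k + 9) * (2 ^ 16 * ((k + 2) * (k + 1)) ^ 6) :=
          Nat.mul_le_mul_right _ ih
      _ = 2 ^ 15 * (k + 2) ^ 6 * (2 ^ 16 * (k + 1) ^ (12 * k + 15)) := by ring
      _ ≤ 2 ^ 15 * (k + 2) ^ 6 * (k + 2) ^ (12 * k + 15) :=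
          Nat.mul_le_mul_left _ (two_pow_mul_pow_le k hk)
      _ = 2 ^ 15 * (k + 1 + 1) ^ (12 * (k + 1) + 9) := by ring

/-- For k + 1 = ⌊√n⌋ the exponent suffices because √n ≤ k + 2. -/
theorem two_pow_le_boundedCard_pow (k n : ℕ) (hk : 23 ≤ k) (hn : (k + 1) ^ 2 ≤ n) :
    2 ^ (32 * (k + 2)) ≤ boundedCard (k + 1) n ^ 12 * 2 ^ 30 * n ^ 9 := by
  have hf : 0 < ((k + 1)! * k !) ^ 12 := by positivity
  refine Nat.le_of_mul_le_mul_right ?_ hf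
  calc 2 ^ (32 * (k + 2)) * ((k + 1)! * k !) ^ 12
      = (2 ^ (16 * (k + 2)) * ((k + 1)! * k !) ^ 6) ^ 2 := by ring
    _ ≤ (2 ^ 15 * (k + 1) ^ (12 * k + 9)) ^ 2 :=
      Nat.pow_le_pow_left (two_pow_mul_factorial_le k hk) 2
    _ = (((k + 1) ^ 2) ^ k) ^ 12 * 2 ^ 30 * ((k + 1) ^ 2) ^ 9 := by
      generalize k + 1 = m; ring
    _ ≤ (n ^ k) ^ 12 * 2 ^ 30 * n ^ 9 := by gcongr
    _ ≤ (boundedCard (k + 1) n * ((k + 1)! * k !)) ^ 12 * 2 ^ 30 * n ^ 9 := by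
      gcongr; exact pow_le_boundedCard_mul k n
    _ = boundedCard (k + 1) n ^ 12 * 2 ^ 30 * n ^ 9 * ((k + 1)! * k !) ^ 12 := by ring

/-- Passes from a list of values for parts at most `k` to one for parts at most `k + 1`;
`acc` collects the new values in reverse order. -/
def nextRow (k : ℕ) : List ℕ → List ℕ → List ℕ
  | acc, [] => acc.reverse
  | acc, a :: t => nextRow k ((a + acc.getD k 0) :: acc) t

/-- The numbers of partitions of `0, …, N - 1` with parts at most `k + 1`. -/
def row (N : ℕ) : ℕ → List ℕ
  | 0 => List.replicate N 1
  | k + 1 => nextRow (k + 1) [] (row N k)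

theorem nextRow_le (k : ℕ) (l acc : List ℕ)
    (hl : ∀ i, l.getD i 0 ≤ boundedCard k (acc.length + i))
    (hacc : ∀ i < acc.length, acc.getD i 0 ≤ boundedCard (k + 1) (acc.length - 1 - i)) (i : ℕ) :
    (nextRow k acc l).getD i 0 ≤ boundedCard (k + 1) i := by
  induction l generalizing acc with
  | nil =>
    rw [nextRow]
    rcases lt_or_ge i acc.length with h | h
    · have := hacc (acc.length - 1 - i) (by omega)
      rw [show acc.length - 1 - (acc.length - 1 - i) = i by omega] at this
      simpa [List.getD_eq_getElem?_getD, List.getElem?_reverse h] using this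
    · simp [List.getD_eq_getElem?_getD, h]
  | cons a t ih =>
    rw [nextRow]
    refine ih _ (fun j => ?_) (fun j hj => ?_)
    · have := hl (j + 1)
      rw [List.getD_cons_succ] at this
      rw [List.length_cons, add_assoc, add_comm 1 j]
      exact this
    · cases j with
      | zero =>
        have ha := hl 0
        rw [List.getD_cons_zero] at ha
        simp only [List.getD_cons_zero, List.length_cons, Nat.add_sub_cancel, Nat.sub_zero]
        rw [Nat.add_zero] at ha
        rcases lt_or_ge k acc.length with h | h
        · obtain ⟨m, hm⟩ := Nat.exists_eq_add_of_le' (Nat.succ_le_of_lt h)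
          have h1 := hacc k h
          have h2 := boundedCard_add_le k m
          rw [show acc.length - 1 - k = m by omega] at h1
          have hm' : acc.length = m + (k + 1) := hm
          rw [hm'] at ha ⊢
          omega
        -- Here k + 1 exceeds the number being partitioned, so the default 0 is the right
        -- contribution.
        · rw [List.getD_eq_default _ _ h]
          exact ha.trans (boundedCard_mono k.le_succ _)
      | succ j =>
        rw [List.length_cons] at hj ⊢
        rw [List.getD_cons_succ, show acc.length + 1 - 1 - (j + 1) = acc.length - 1 - j by omega]
        exact hacc j (by omega)

theorem row_le (N k i : ℕ) : (row N k).getD i 0 ≤ boundedCard (k + 1) i := by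
  induction k generalizing i with
  | zero =>
    rw [row]
    rcases lt_or_ge i N with h | h
    · simpa [List.getD_eq_getElem?_getD, h] using one_le_boundedCard_one i
    · simp [List.getD_eq_getElem?_getD, h]
  | succ k ih => exact nextRow_le _ _ _ (fun i => by simpa using ih i) (by simp) i

/-- Checks the twelfth power of the bound for consecutive integers starting at `n`. -/
def checkFrom : ℕ → List ℕ → Bool
  | _, [] => true
  | n, a :: t => Nat.ble (2 ^ (Nat.sqrt (1024 * n) + 1)) (a ^ 12 * 2 ^ 30 * n ^ 9) &&
      checkFrom (n + 1) t

theorem le_of_checkFrom (n : ℕ) (l : List ℕ) (h : checkFrom n l = true) (i : ℕ)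
    (hi : i < l.length) :
    2 ^ (Nat.sqrt (1024 * (n + i)) + 1) ≤ l.getD i 0 ^ 12 * 2 ^ 30 * (n + i) ^ 9 := by
  induction l generalizing n i with
  | nil => simp at hi
  | cons a t ih =>
    rw [checkFrom, Bool.and_eq_true] at h
    cases i with
    | zero => exact Nat.le_of_ble_eq_true h.1
    | succ i =>
      have := ih (n + 1) h.2 i (by simpa using hi)
      rw [show n + (i + 1) = n + 1 + i by omega, List.getD_cons_succ]
      exact this

theorem checkFrom_row : ((row 576 15).drop 2).length = 574 ∧
    checkFrom 2 ((row 576 15).drop 2) = true := by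
  decide +kernel

theorem two_pow_le_boundedCard_pow_of_lt (n : ℕ) (hn : 2 ≤ n) (hn' : n < 576) :
    2 ^ (Nat.sqrt (1024 * n) + 1) ≤ boundedCard 16 n ^ 12 * 2 ^ 30 * n ^ 9 := by
  obtain ⟨i, rfl⟩ := Nat.exists_eq_add_of_le hn
  refine (le_of_checkFrom 2 _ checkFrom_row.2 i (by rw [checkFrom_row.1]; omega)).trans ?_
  have h := row_le 576 15 (2 + i)
  have hd : ((row 576 15).drop 2).getD i 0 = (row 576 15).getD (2 + i) 0 := by
    simp only [List.getD_eq_getElem?_getD, List.getElem?_drop]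
  rw [hd]
  gcongr

theorem rpow_div_le (N n a : ℕ) (hn : 0 < n) (ha : 32 * √(n : ℝ) ≤ a)
    (h : 2 ^ a ≤ N ^ 12 * 2 ^ 30 * n ^ 9) :
    (2 : ℝ) ^ (8 * √(n : ℝ) / 3) / ((2 : ℝ) ^ ((5 : ℝ) / 2) * (n : ℝ) ^ ((3 : ℝ) / 4)) ≤ N := by
  have hn' : (0 : ℝ) < n := by exact_mod_cast hn
  rw [div_le_iff₀ (by positivity)]
  refine le_of_pow_le_pow_left₀ (n := 12) (by norm_num) (by positivity) ?_
  have h1 : ((2 : ℝ) ^ (8 * √(n : ℝ) / 3)) ^ 12 = (2 : ℝ) ^ (32 * √(n : ℝ)) := by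
    rw [← Real.rpow_mul_natCast (by norm_num)]; congr 1; push_cast; ring
  have h2 : ((2 : ℝ) ^ ((5 : ℝ) / 2)) ^ 12 = 2 ^ 30 := by
    rw [← Real.rpow_mul_natCast (by norm_num), ← Real.rpow_natCast]; norm_num
  have h3 : ((n : ℝ) ^ ((3 : ℝ) / 4)) ^ 12 = (n : ℝ) ^ 9 := by
    rw [← Real.rpow_mul_natCast hn'.le, ← Real.rpow_natCast]; norm_num
  rw [mul_pow, mul_pow, h1, h2, h3, ← mul_assoc]
  calc (2 : ℝ) ^ (32 * √(n : ℝ)) ≤ (2 : ℝ) ^ (a : ℝ) :=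
        Real.rpow_le_rpow_of_exponent_le (by norm_num) ha
    _ = (2 : ℝ) ^ a := Real.rpow_natCast _ _
    _ ≤ (N : ℝ) ^ 12 * 2 ^ 30 * (n : ℝ) ^ 9 := by exact_mod_cast h

theorem rpow_div_le_boundedCard (n : ℕ) (hn : 2 ≤ n) :
    ∃ k, (2 : ℝ) ^ (8 * √(n : ℝ) / 3) / ((2 : ℝ) ^ ((5 : ℝ) / 2) * (n : ℝ) ^ ((3 : ℝ) / 4)) ≤
      boundedCard k n := by
  rcases lt_or_ge n 576 with h | h
  · refine ⟨16, rpow_div_le _ n _ (by omega) ?_ (two_pow_le_boundedCard_pow_of_lt n hn h)⟩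
    -- Rounding √(1024 n), not √n, keeps the loss in the exponent at most 1.
    have h32 : 32 * √(n : ℝ) = √((1024 * n : ℕ) : ℝ) := by
      push_cast
      rw [Real.sqrt_mul (by norm_num), show (1024 : ℝ) = 32 ^ 2 by norm_num,
        Real.sqrt_sq (by norm_num)]
    rw [h32]
    push_cast [-Nat.cast_mul]
    exact Real.real_sqrt_le_nat_sqrt_succ
  · have hs : 24 ≤ Nat.sqrt n := Nat.le_sqrt.2 (by omega)
    obtain ⟨k, hk⟩ := Nat.exists_eq_add_of_le' (show 1 ≤ Nat.sqrt n by omega)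
    have hsq : (k + 1) ^ 2 ≤ n := by rw [← hk]; exact Nat.sqrt_le' n
    refine ⟨k + 1, rpow_div_le _ n _ (by omega) ?_
      (two_pow_le_boundedCard_pow k n (by omega) hsq)⟩
    have := Real.real_sqrt_le_nat_sqrt_succ (a := n)
    rw [hk] at this
    push_cast at this ⊢
    linarith

end Nat.Partition

theorem mainTheorem2 (n : ℕ) (hn : 2 ≤ n) :
    (Fintype.card (Nat.Partition n) : ℝ) ≥
      (2 : ℝ) ^ (8 * Real.sqrt (n : ℝ) / 3) /
        ((2 : ℝ) ^ ((5 : ℝ) / 2) * (n : ℝ) ^ ((3 : ℝ) / 4)) := by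
  obtain ⟨k, hk⟩ := Nat.Partition.rpow_div_le_boundedCard n hn
  exact hk.trans (by exact_mod_cast Nat.Partition.boundedCard_le_card k n)
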